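/- Let $X$ be a real Banach space with dual $X^*$, and let $f:X\to\mathbb R\cup\{+\infty\}$ be proper, i.e. $\mathrm{dom}\,f:=\{x: f(x)<+\infty\}\neq\emptyset$. Suppose that $f$ is superlinear: for every $c>0$ there exists $\delta>0$ such that $f(x)\ge c\|x\|$ for all $x\in X$ with $\|x\|>\delta$. Let $$\partial f(x):=\{\xi\in X^*:\ x \text{ is a global minimizer of } f-\xi \text{ on } X\},\qquad \mathrm{Im}\,\partial f:=\bigcup_{x\in X}\partial f(x).$$ A set $\mathcal W\subset X$ has the Radon--Nikodým property (RNP) if each nonempty bounded subset $B\subset \mathcal W$ is dentable: for every $\varepsilon>0$ there exist $\delta>0$ and $\xi\in X^*$ such that the slice $\{v\in B:\langle\xi,v\rangle<\inf_{w\in B}\langle\xi,w\rangle+\delta\}$ has diameter less than $\varepsilon$. Then the following statements hold. (i) If $X$ is reflexive and $f$ is weakly lower semicontinuous, then $\mathrm{Im}\,\partial f=X^*$. (ii) If $f$ is lower semicontinuous and bounded from below, and the closed convex hull $\overline{\mathrm{conv}}(\mathrm{dom}\,f)$ has the RNP, then $\mathrm{Im}\,\partial f$ is dense in $X^*$ for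 the norm topology, i.e. $\overline{\mathrm{Im}\,\partial f}=X^*$. -/

import Mathlib

/-- The effective domain `dom f = {x | f x < +∞}` of an extended-real-valued function. -/
def effDom {X : Type*} (f : X → EReal) : Set X := {x | f x < ⊤}

/-- `f` takes values in `ℝ ∪ {+∞}` and is not identically `+∞`. -/
def IsProperFun {X : Type*} (f : X → EReal) : Prop :=
  (∀ x, f x ≠ ⊥) ∧ (effDom f).Nonempty

/-- For every `c > 0` there is `δ > 0` with `f x ≥ c‖x‖` outside the closed ball `B(0, δ)`. -/
def IsSuperlinear {X : Type*} [NormedAddCommGroup X] (f : X → EReal) : Prop :=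
  ∀ c : ℝ, 0 < c → ∃ δ : ℝ, 0 < δ ∧
    ∀ x, x ∉ Metric.closedBall (0 : X) δ → ((c * ‖x‖ : ℝ) : EReal) ≤ f x

/-- The Fenchel-Moreau subdifferential: all `ξ ∈ X*` such that `x` is a (global) minimizer
of `f - ξ`. -/
def fenchelSubdiff {X : Type*} [NormedAddCommGroup X] [NormedSpace ℝ X]
    (f : X → EReal) (x : X) : Set (StrongDual ℝ X) :=
  {ξ | ∀ y, f x - ((ξ x : ℝ) : EReal) ≤ f y - ((ξ y : ℝ) : EReal)}

/-- The image `{y | ∃ x, y ∈ F x}` of a set-valued mapping. -/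
def setValuedIm {X Y : Type*} (F : X → Set Y) : Set Y := {y | ∃ x, y ∈ F x}

/-- Lower semicontinuity with respect to the weak topology of `X`. -/
def IsWeaklyLSC {X : Type*} [NormedAddCommGroup X] [NormedSpace ℝ X] (f : X → EReal) : Prop :=
  LowerSemicontinuous (fun x : WeakSpace ℝ X => f ((toWeakSpace ℝ X).symm x))

/-- Reflexivity: the canonical embedding into the bidual is onto. -/
def IsReflexiveSpace (X : Type*) [NormedAddCommGroup X] [NormedSpace ℝ X] : Prop :=
  Function.Surjective (NormedSpace.inclusionInDoubleDual ℝ X)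

/-- The slice `{v ∈ W | ⟨ξ, v⟩ < inf_{w ∈ W} ⟨ξ, w⟩ + δ}`, the infimum being taken in `[-∞, +∞]`. -/
def lowerSlice {X : Type*} [NormedAddCommGroup X] [NormedSpace ℝ X]
    (W : Set X) (ξ : StrongDual ℝ X) (δ : ℝ) : Set X :=
  {v | v ∈ W ∧ ((ξ v : ℝ) : EReal) < (⨅ w ∈ W, ((ξ w : ℝ) : EReal)) + ((δ : ℝ) : EReal)}

/-- A set is dentable if it has slices of arbitrarily small diameter
(the diameter is `[0, +∞]`-valued). -/
def IsDentable {X : Type*} [NormedAddCommGroup X] [NormedSpace ℝ X] (W : Set X) : Prop :=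
  ∀ ε : ℝ, 0 < ε → ∃ δ : ℝ, 0 < δ ∧ ∃ ξ : StrongDual ℝ X,
    Metric.ediam (lowerSlice W ξ δ) < ENNReal.ofReal ε

/-- The Radon-Nikodym property of a set: every nonempty bounded subset is dentable. -/
def HasRNP {X : Type*} [NormedAddCommGroup X] [NormedSpace ℝ X] (W : Set X) : Prop :=
  ∀ B : Set X, B ⊆ W → B.Nonempty → Bornology.IsBounded B → IsDentable B

/-! For (i), superlinearity keeps `f - ξ` above `‖x‖` far from the origin. A minimum may therefore
be sought on a large ball, which is weakly relatively compact by reflexivity.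

For (ii), let `F` be the real part of `f` on its domain and `g ξ = sup (ξ - F)`. Superlinearity and
the lower bound make `g` bounded on bounded sets. If near-maximizers of `ξ - F` cluster together,
maximizing sequences are Cauchy, and by lower semicontinuity their limit minimizes `f - ξ`. By
Baire's theorem it suffices to get clustering at each scale on an open dense set of `ξ`.

Near-maximizers lie close to subgradients of `g` in `X` at nearby functionals
(`exists_mem_predualSubdiff_near`, from Ekeland and Hahn–Banach). Near a given functional these
subgradients form a bounded subset of the closed convex hull of the domain, so the RNP yields a
small slice of them, cut by some `v`. If `ξ` has a subgradient in the slice, monotonicity forces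
every subgradient at functionals near `ξ - t • v` into it. -/

/-- The points of the predual that are subgradients of `g` at `ξ`. -/
def predualSubdiff {X : Type*} [NormedAddCommGroup X] [NormedSpace ℝ X]
    (g : StrongDual ℝ X → ℝ) (ξ : StrongDual ℝ X) : Set X :=
  {a | ∀ ζ, g ξ + (ζ - ξ) a ≤ g ζ}

/-- The epigraph of the conjugate of `g`, as a subset of `X × ℝ`. -/
def predualEpigraph {X : Type*} [NormedAddCommGroup X] [NormedSpace ℝ X]
    (g : StrongDual ℝ X → ℝ) : Set (X × ℝ) :=
  {p | ∀ ζ, ζ p.1 - g ζ ≤ p.2}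

theorem isClosed_predualEpigraph {X : Type*} [NormedAddCommGroup X] [NormedSpace ℝ X]
    (g : StrongDual ℝ X → ℝ) : IsClosed (predualEpigraph g) := by
  simp only [predualEpigraph, Set.ofPred_forall]
  exact isClosed_iInter fun ζ => isClosed_le (by fun_prop) (by fun_prop)

theorem convex_predualEpigraph {X : Type*} [NormedAddCommGroup X] [NormedSpace ℝ X]
    (g : StrongDual ℝ X → ℝ) : Convex ℝ (predualEpigraph g) := by
  intro p hp q hq a b ha hb hab ζ
  have h1 := mul_le_mul_of_nonneg_left (hp ζ) ha
  have h2 := mul_le_mul_of_nonneg_left (hq ζ) hb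
  simp only [Prod.fst_add, Prod.smul_fst, map_add, map_smul, smul_eq_mul, Prod.snd_add,
    Prod.smul_snd]
  have : g ζ = a * g ζ + b * g ζ := by rw [← add_mul, hab, one_mul]
  linarith

/-! ### Ekeland's principle and Brøndsted–Rockafellar approximation -/

/-- Ekeland's variational principle for `p ↦ p.2 - ξ p.1` on a closed subset of `X × ℝ`, with a
penalty that only sees the first coordinate. -/
theorem exists_penalized_min {X : Type*} [NormedAddCommGroup X] [NormedSpace ℝ X]
    [CompleteSpace X] {H : Set (X × ℝ)} (hH : IsClosed H) (ξ : StrongDual ℝ X) {κ m : ℝ}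
    (hκ : 0 < κ) (hm : ∀ p ∈ H, m ≤ p.2 - ξ p.1) {p₀ : X × ℝ} (hp₀ : p₀ ∈ H) :
    ∃ p ∈ H, κ * ‖p.1 - p₀.1‖ ≤ (p₀.2 - ξ p₀.1) - (p.2 - ξ p.1) ∧
      ∀ q ∈ H, p.2 - ξ p.1 ≤ q.2 - ξ q.1 + κ * ‖q.1 - p.1‖ := by
  set φ : X × ℝ → ℝ := fun p => p.2 - ξ p.1 with hφ
  have step : ∀ (n : ℕ) (p : H), ∃ q : H, φ q + κ * ‖q.1.1 - p.1.1‖ ≤ φ p ∧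
      ∀ r ∈ H, φ r + κ * ‖r.1 - p.1.1‖ ≤ φ p → φ q ≤ φ r + 1 / ((n : ℝ) + 1) := by
    intro n p
    let S : Set ℝ := φ '' {r | r ∈ H ∧ φ r + κ * ‖r.1 - p.1.1‖ ≤ φ p}
    have hne : S.Nonempty := ⟨φ p, p, ⟨p.2, by simp⟩, rfl⟩
    have hbd : BddBelow S := ⟨m, by rintro _ ⟨r, hr, rfl⟩; exact hm r hr.1⟩
    obtain ⟨_, ⟨q, hq, rfl⟩, hlt⟩ := exists_lt_of_csInf_lt hne
      (lt_add_of_pos_right (sInf S) (Nat.one_div_pos_of_nat (α := ℝ) (n := n)))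
    refine ⟨⟨q, hq.1⟩, hq.2, fun r hr hr' => ?_⟩
    have := csInf_le hbd (Set.mem_image_of_mem φ (show r ∈ {r | r ∈ H ∧ _} from ⟨hr, hr'⟩))
    linarith
  choose next hnext hinf using step
  let u : ℕ → H := fun n => Nat.rec ⟨p₀, hp₀⟩ next n
  have hu : ∀ n, u (n + 1) = next n (u n) := fun n => rfl
  have hdec : ∀ n k, φ (u (n + k)).1 + κ * ‖(u (n + k)).1.1 - (u n).1.1‖ ≤ φ (u n).1 := by
    intro n k
    induction k with
    | zero => simp
    | succ k ih =>
      have h1 := hnext (n + k) (u (n + k))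
      rw [← hu] at h1
      have h2 := mul_le_mul_of_nonneg_left
        (norm_sub_le_norm_sub_add_norm_sub (u (n + k + 1)).1.1 (u (n + k)).1.1 (u n).1.1) hκ.le
      rw [← add_assoc]
      linarith
  have hanti : Antitone fun n => φ (u n).1 := antitone_nat_of_succ_le fun n => by
    have := hdec n 1
    have h2 := mul_nonneg hκ.le (norm_nonneg ((u (n + 1)).1.1 - (u n).1.1))
    linarith
  have hbd : BddBelow (Set.range fun n => φ (u n).1) :=
    ⟨m, by rintro _ ⟨n, rfl⟩; exact hm _ (u n).2⟩
  have hlim := tendsto_atTop_ciInf hanti hbd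
  set l := ⨅ n, φ (u n).1
  have hl : ∀ n, l ≤ φ (u n).1 := fun n => ciInf_le hbd n
  have hcau : CauchySeq fun n => (u n).1.1 := by
    refine cauchySeq_of_le_tendsto_0' (fun n => (φ (u n).1 - l) / κ) ?_ ?_
    · intro n k hnk
      obtain ⟨j, rfl⟩ := Nat.exists_eq_add_of_le hnk
      rw [dist_comm, dist_eq_norm, le_div_iff₀ hκ, mul_comm]
      linarith [hdec n j, hl (n + j)]
    · simpa using (hlim.sub_const l).div_const κ
  obtain ⟨a, ha⟩ := cauchySeq_tendsto_of_complete hcau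
  -- The penalty controls only first coordinates; the second ones converge because `φ` decreases to
  -- `l` and `ξ` is continuous.
  have hsnd : Filter.Tendsto (fun n => (u n).1.2) Filter.atTop (nhds (l + ξ a)) := by
    have := hlim.add ((ξ.continuous.tendsto a).comp ha)
    refine this.congr fun n => ?_
    simp [hφ]
  have hpt : Filter.Tendsto (fun n => (u n).1) Filter.atTop (nhds (a, l + ξ a)) :=
    ha.prodMk_nhds hsnd
  have hpH : (a, l + ξ a) ∈ H := hH.mem_of_tendsto hpt (Filter.Eventually.of_forall fun n => (u n).2)
  have hle : ∀ n, l + κ * ‖a - (u n).1.1‖ ≤ φ (u n).1 := by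
    intro n
    refine le_of_tendsto (hlim.add (((ha.sub_const _).norm).const_mul κ)) ?_
    filter_upwards [Filter.eventually_ge_atTop n] with k hk
    obtain ⟨j, rfl⟩ := Nat.exists_eq_add_of_le hk
    exact hdec n j
  refine ⟨_, hpH, ?_, fun q hq => ?_⟩
  · have := hle 0
    simp only [hφ] at this ⊢
    change l + κ * ‖a - p₀.1‖ ≤ p₀.2 - ξ p₀.1 at this
    linarith
  -- A violating `q` competes at every stage, so near-minimality gives `l ≤ φ q` in the limit,
  -- against `hlt`.
  · by_contra! hlt
    simp only [add_sub_cancel_right] at hlt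
    have hq' : ∀ n : ℕ, l ≤ φ q + 1 / ((n : ℝ) + 1) := by
      intro n
      have h1 := norm_sub_le_norm_sub_add_norm_sub q.1 a (u n).1.1
      have h2 := mul_le_mul_of_nonneg_left h1 hκ.le
      have h3 := hinf n (u n) q hq (by linarith [hle n])
      rw [← hu] at h3
      linarith [hl (n + 1)]
    have h0 : l ≤ φ q + 0 :=
      ge_of_tendsto' (tendsto_one_div_add_atTop_nhds_zero_nat.const_add (φ q)) hq'
    have := mul_nonneg hκ.le (norm_nonneg (q.1 - a))
    simp only [hφ] at h0
    linarith

/-- A point of a convex set that minimizes `p.2 - ξ p.1 + κ * ‖p.1 - a‖` minimizes some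
`p.2 - ξ' p.1` with `‖ξ' - ξ‖ ≤ κ`. -/
theorem Convex.exists_dual_of_penalized_min {X : Type*} [NormedAddCommGroup X] [NormedSpace ℝ X]
    {H : Set (X × ℝ)} (hH : Convex ℝ H) (ξ : StrongDual ℝ X) {κ : ℝ} (hκ : 0 ≤ κ) {p : X × ℝ}
    (hp : p ∈ H) (hmin : ∀ q ∈ H, p.2 - ξ p.1 ≤ q.2 - ξ q.1 + κ * ‖q.1 - p.1‖) :
    ∃ ξ' : StrongDual ℝ X, ‖ξ' - ξ‖ ≤ κ ∧ ∀ q ∈ H, p.2 - ξ' p.1 ≤ q.2 - ξ' q.1 := by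
  let O : Set (X × ℝ) := {q | q.2 - ξ q.1 + κ * ‖q.1 - p.1‖ < p.2 - ξ p.1}
  have hOo : IsOpen O := isOpen_lt (by fun_prop) (by fun_prop)
  have hOc : Convex ℝ O := by
    intro q hq r hr s t hs ht hst
    have key : ConvexOn ℝ Set.univ fun q : X × ℝ => q.2 - ξ q.1 + κ * ‖q.1 - p.1‖ := by
      refine ConvexOn.add ?_ ?_
      · exact ((LinearMap.snd ℝ X ℝ) - ξ.toLinearMap ∘ₗ (LinearMap.fst ℝ X ℝ)).convexOn convex_univ
      · have h1 : ConvexOn ℝ Set.univ fun q : X × ℝ => ‖q.1 - p.1‖ := by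
          have := (convexOn_univ_norm (E := X)).translate_right (-p.1)
          have h2 := this.comp_linearMap (LinearMap.fst ℝ X ℝ)
          simpa [Function.comp_def, sub_eq_add_neg, add_comm] using h2
        simpa using h1.smul hκ
    have := (key.convex_lt (p.2 - ξ p.1))
    simp only [Set.mem_univ, true_and] at this
    exact this hq hr hs ht hst
  have hdisj : Disjoint O H := by
    rw [Set.disjoint_left]
    intro q hq hqH
    exact (hmin q hqH).not_gt hq
  obtain ⟨Φ, c, hΦO, hΦH⟩ := geometric_hahn_banach_open hOc hOo hH hdisj
  set w : StrongDual ℝ X := Φ.comp (ContinuousLinearMap.inl ℝ X ℝ) with hw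
  set lam : ℝ := Φ (0, 1) with hlam
  have hΦ : ∀ q : X × ℝ, Φ q = w q.1 + lam * q.2 := by
    intro q
    have : q = (q.1, (0 : ℝ)) + q.2 • ((0 : X), (1 : ℝ)) := by ext <;> simp
    conv_lhs => rw [this]
    rw [map_add, map_smul, smul_eq_mul, mul_comm]
    simp [hw, hlam]
  have hpc := hΦH p hp
  have hlampos : 0 < lam := by
    have : (p.1, p.2 - 1) ∈ O := by simp [O]
    have := hΦO _ this
    rw [hΦ] at this hpc
    simp only at this
    nlinarith
  -- Points of `O` just below the downward cone with apex `p` bound the separating functional; after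
  -- division by `lam` this is the norm bound on `ξ' - ξ`.
  have hO : ∀ y : X, w y + lam * (ξ y - κ * ‖y‖) ≤ 0 := by
    intro y
    have h : ∀ s : ℝ, 0 < s → w y + lam * (ξ y - κ * ‖y‖) ≤ 0 + lam * s := by
      intro s hs
      have : (p.1 + y, p.2 + ξ y - κ * ‖y‖ - s) ∈ O := by
        simp [O]; linarith
      have := hΦO _ this
      rw [hΦ] at this hpc
      simp only [map_add] at this
      nlinarith
    refine le_of_forall_pos_le_add fun s hs => ?_
    have := h (s / lam) (div_pos hs hlampos)
    rwa [mul_div_cancel₀ _ hlampos.ne'] at this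
  have hc : c = Φ p := by
    refine le_antisymm hpc (le_of_forall_pos_le_add fun s hs => ?_)
    have : (p.1, p.2 - s / lam) ∈ O := by simp [O]; positivity
    have := hΦO _ this
    rw [hΦ] at this ⊢
    simp only [mul_sub, mul_div_cancel₀ _ hlampos.ne'] at this
    linarith
  have hval : ∀ y, (-(lam⁻¹) • w) y = -(w y / lam) := fun y => by simp [div_eq_inv_mul]
  refine ⟨-(lam⁻¹) • w, ?_, fun q hq => ?_⟩
  · have hone : ∀ y, ξ y - (-(lam⁻¹) • w) y ≤ κ * ‖y‖ := by
      intro y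
      have h1 := hO y
      rw [hval]
      have h2 : lam * (ξ y - -(w y / lam)) ≤ lam * (κ * ‖y‖) := by
        rw [sub_neg_eq_add, mul_add, mul_div_cancel₀ _ hlampos.ne']
        linarith
      exact le_of_mul_le_mul_left h2 hlampos
    refine ContinuousLinearMap.opNorm_le_bound _ hκ fun y => ?_
    rw [_root_.sub_apply, Real.norm_eq_abs, abs_le]
    have h1 := hone y
    have h2 := hone (-y)
    rw [map_neg, map_neg, norm_neg] at h2
    constructor <;> linarith
  · have h1 := hΦH q hq
    rw [hc, hΦ, hΦ] at h1
    rw [hval, hval]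
    have h2 : lam * (p.2 - -(w p.1 / lam)) ≤ lam * (q.2 - -(w q.1 / lam)) := by
      rw [sub_neg_eq_add, mul_add, mul_div_cancel₀ _ hlampos.ne', sub_neg_eq_add, mul_add,
        mul_div_cancel₀ _ hlampos.ne']
      linarith
    exact le_of_mul_le_mul_left h2 hlampos

/-- Brøndsted–Rockafellar for the conjugate `g` of `F` on `D`: near-maximizers of `ξ - F` are
close to predual subgradients at functionals close to `ξ`. -/
theorem exists_mem_predualSubdiff_near {X : Type*} [NormedAddCommGroup X] [NormedSpace ℝ X]
    [CompleteSpace X] {D : Set X} {F : X → ℝ} {g : StrongDual ℝ X → ℝ}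
    (hg : ∀ ξ : StrongDual ℝ X, IsLUB ((fun x => ξ x - F x) '' D) (g ξ))
    (ξ : StrongDual ℝ X) {x : X} (hx : x ∈ D) {α κ : ℝ} (hκ : 0 < κ)
    (hα : g ξ ≤ ξ x - F x + α) :
    ∃ (ξ' : StrongDual ℝ X) (a : X), a ∈ predualSubdiff g ξ' ∧ ‖ξ' - ξ‖ ≤ κ ∧
      κ * ‖a - x‖ ≤ α := by
  have hepi : ∀ y ∈ D, (y, F y) ∈ predualEpigraph g := fun y hy ζ => by
    have := (hg ζ).1 (Set.mem_image_of_mem _ hy)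
    simp only at this ⊢
    linarith
  obtain ⟨p, hp, hpx, hmin⟩ := exists_penalized_min (isClosed_predualEpigraph g) ξ hκ
    (m := -g ξ) (fun p hp => by linarith [hp ξ]) (hepi x hx)
  obtain ⟨ξ', hξ', hH⟩ :=
    (convex_predualEpigraph g).exists_dual_of_penalized_min ξ hκ.le hp hmin
  refine ⟨ξ', p.1, fun ζ => ?_, hξ', ?_⟩
  -- The epigraph contains the graph of `F`, so minimality of `p` gives equality in the
  -- Fenchel–Young inequality at `ξ'`.
  · have h1 : g ξ' ≤ ξ' p.1 - p.2 := by
      refine (hg ξ').2 ?_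
      rintro _ ⟨y, hy, rfl⟩
      have := hH _ (hepi y hy)
      simp only at this ⊢
      linarith
    have h2 := hp ζ
    rw [_root_.sub_apply]
    linarith
  · have := hp ξ
    simp only at hpx
    linarith

/-! ### Location, monotonicity and boundedness of predual subgradients -/

/-- If `v` separates `a` from the hull at level `u`, adding `v` to `ξ` raises `g` by at most `u`,
whereas a subgradient `a` would force a rise of `v a > u`. -/
theorem predualSubdiff_subset_closedConvexHull {X : Type*} [NormedAddCommGroup X]
    [NormedSpace ℝ X] {D : Set X} {F : X → ℝ} {g : StrongDual ℝ X → ℝ}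
    (hg : ∀ ξ : StrongDual ℝ X, IsLUB ((fun x => ξ x - F x) '' D) (g ξ))
    (ξ : StrongDual ℝ X) : predualSubdiff g ξ ⊆ closedConvexHull ℝ D := by
  intro a ha
  by_contra hnot
  obtain ⟨v, u, hv, hu⟩ := geometric_hahn_banach_closed_point
    (convex_closedConvexHull (𝕜 := ℝ) (s := D)) isClosed_closedConvexHull hnot
  have h1 : g (ξ + v) ≤ g ξ + u := by
    refine (hg (ξ + v)).2 ?_
    rintro _ ⟨y, hy, rfl⟩
    have h1 := (hg ξ).1 (Set.mem_image_of_mem _ hy)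
    have h2 := hv y (subset_closedConvexHull hy)
    simp only [add_apply] at h1 ⊢
    linarith
  have h2 := ha (ξ + v)
  rw [add_sub_cancel_left] at h2
  linarith

theorem predualSubdiff_monotone {X : Type*} [NormedAddCommGroup X] [NormedSpace ℝ X]
    {g : StrongDual ℝ X → ℝ} {ξ ζ : StrongDual ℝ X} {a b : X}
    (ha : a ∈ predualSubdiff g ξ) (hb : b ∈ predualSubdiff g ζ) : 0 ≤ (ζ - ξ) (b - a) := by
  have h1 := ha ζ
  have h2 := hb ξ
  simp only [_root_.sub_apply, map_sub] at *
  linarith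

/-- Testing the subgradient inequality at `ξ + w`, with `w` norming `a`, bounds `‖a‖` by the
increment of `g`. -/
theorem norm_le_of_mem_predualSubdiff {X : Type*} [NormedAddCommGroup X] [NormedSpace ℝ X]
    {g : StrongDual ℝ X → ℝ} {ξ : StrongDual ℝ X} {R C : ℝ} (hξ : ‖ξ‖ ≤ R)
    (hC : ∀ ζ : StrongDual ℝ X, ‖ζ‖ ≤ R + 1 → |g ζ| ≤ C) {a : X}
    (ha : a ∈ predualSubdiff g ξ) : ‖a‖ ≤ 2 * C := by
  obtain ⟨w, hw, hwa⟩ := exists_dual_vector'' ℝ a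
  have h1 := ha (ξ + w)
  have h2 := abs_le.1 (hC ξ (by linarith))
  have h3 := abs_le.1 (hC (ξ + w) ((norm_add_le _ _).trans (add_le_add hξ hw)))
  rw [add_sub_cancel_left, hwa] at h1
  simp only [RCLike.ofReal_real_eq_id, id_eq] at h1
  linarith

/-! ### Stegall's argument: dentability and Baire category -/

/-- If the bounded sets of predual subgradients are dentable then every functional is approximated
by functionals near which the near-maximizers of `ζ - F` are uniformly close to each other. -/
theorem exists_uniformly_small_near_maximizers {X : Type*} [NormedAddCommGroup X]
    [NormedSpace ℝ X] [CompleteSpace X] {D : Set X} {F : X → ℝ} {g : StrongDual ℝ X → ℝ}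
    (hg : ∀ ξ : StrongDual ℝ X, IsLUB ((fun x => ξ x - F x) '' D) (g ξ))
    (hbd : ∀ R : ℝ, ∃ C : ℝ, ∀ ξ : StrongDual ℝ X, ‖ξ‖ ≤ R → |g ξ| ≤ C)
    (hD : HasRNP (closedConvexHull ℝ D : Set X)) (ξ₀ : StrongDual ℝ X) {η ε : ℝ} (hη : 0 < η)
    (hε : 0 < ε) :
    ∃ ξ₁ : StrongDual ℝ X, ‖ξ₁ - ξ₀‖ < η ∧ ∃ ρ > 0, ∃ α > 0, ∀ ζ : StrongDual ℝ X,
      ‖ζ - ξ₁‖ < ρ → ∀ x ∈ D, ∀ y ∈ D, g ζ ≤ ζ x - F x + α → g ζ ≤ ζ y - F y + α →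
        ‖x - y‖ < ε := by
  let A : Set X := {a | ∃ ξ : StrongDual ℝ X, ‖ξ - ξ₀‖ < η ∧ a ∈ predualSubdiff g ξ}
  have hAne : A.Nonempty := by
    obtain ⟨_, ⟨x, hx, rfl⟩, hlt, -⟩ := (hg ξ₀).exists_between (sub_one_lt (g ξ₀))
    obtain ⟨ξ', a, ha, hξ', -⟩ := exists_mem_predualSubdiff_near hg ξ₀ hx (half_pos hη)
      (α := 1) (by simp only at hlt; linarith)
    exact ⟨a, ξ', by linarith, ha⟩
  obtain ⟨C, hC⟩ := hbd (‖ξ₀‖ + η + 1)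
  have hAB : ∀ a ∈ A, ‖a‖ ≤ 2 * C := by
    rintro a ⟨ξ, hξ, ha⟩
    refine norm_le_of_mem_predualSubdiff (R := ‖ξ₀‖ + η) ?_ hC ha
    linarith [norm_le_norm_add_norm_sub ξ₀ ξ, norm_sub_rev ξ₀ ξ]
  have hC0 : 0 ≤ C := by
    obtain ⟨a, ha⟩ := hAne
    linarith [hAB a ha, norm_nonneg a]
  obtain ⟨δ, hδ, v, hv⟩ := hD A
    (by rintro a ⟨ξ, -, ha⟩; exact predualSubdiff_subset_closedConvexHull hg ξ ha) hAne
    (isBounded_iff_forall_norm_le.2 ⟨_, hAB⟩) (ε / 3) (by positivity)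
  have hvbd : BddBelow (v '' A) := by
    refine ⟨-(‖v‖ * (2 * C)), ?_⟩
    rintro _ ⟨a, ha, rfl⟩
    have h1 := (v.le_opNorm a).trans (mul_le_mul_of_nonneg_left (hAB a ha) (norm_nonneg v))
    exact (abs_le.1 h1).1
  set i := sInf (v '' A) with hi
  have hslice : ∀ a ∈ A, v a < i + δ → a ∈ lowerSlice A v δ := by
    intro a ha hlt
    refine ⟨ha, ?_⟩
    have h1 : ((i : ℝ) : EReal) ≤ ⨅ w ∈ A, ((v w : ℝ) : EReal) :=
      le_iInf₂ fun w hw => EReal.coe_le_coe_iff.2 (csInf_le hvbd (Set.mem_image_of_mem v hw))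
    calc ((v a : ℝ) : EReal) < ((i + δ : ℝ) : EReal) := EReal.coe_lt_coe_iff.2 hlt
      _ = (i : EReal) + (δ : EReal) := EReal.coe_add _ _
      _ ≤ _ := by gcongr
  have hclose : ∀ a ∈ A, ∀ b ∈ A, v a < i + δ → v b < i + δ → ‖a - b‖ < ε / 3 := by
    intro a ha b hb hav hbv
    have := (Metric.edist_le_ediam_of_mem (hslice a ha hav) (hslice b hb hbv)).trans_lt hv
    rw [edist_dist, ENNReal.ofReal_lt_ofReal_iff (by positivity), dist_eq_norm] at this
    exact this
  obtain ⟨_, ⟨a, ⟨ξ, hξ, ha⟩, rfl⟩, hai⟩ := exists_lt_of_csInf_lt (hAne.image v)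
    (lt_add_of_pos_right i (half_pos hδ))
  set r := η - ‖ξ - ξ₀‖ with hr
  have hrpos : 0 < r := by linarith
  -- The shift by `t • v` costs at most `r / 4` and the later perturbation `2 * κ` at most `r / 2`,
  -- so all functionals stay in the `η`-ball around `ξ₀`. The other bound on `κ` keeps the
  -- monotonicity error `2 * κ * (4 * C)` below `t * δ / 2`.
  set t := r / (4 * (‖v‖ + 1)) with ht
  have htpos : 0 < t := by positivity
  have htv : t * ‖v‖ ≤ r / 4 := by
    rw [ht, div_mul_eq_mul_div, div_le_div_iff₀ (by positivity) (by norm_num)]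
    nlinarith [norm_nonneg v]
  set κ := min (r / 4) (t * δ / (16 * (C + 1))) with hκ
  have hκpos : 0 < κ := by positivity
  have hκr : κ ≤ r / 4 := min_le_left _ _
  have hκδ : κ * (8 * C) < t * δ / 2 := by
    have h1 : κ ≤ t * δ / (16 * (C + 1)) := min_le_right _ _
    rw [le_div_iff₀ (by positivity)] at h1
    nlinarith
  -- The tolerance `κ * (ε / 3)` puts a subgradient `b` within `ε / 3` of `x`. Monotonicity against
  -- `a` gives `v b < v a + δ / 2`, hence `b` is in the slice.
  have hmain : ∀ ζ : StrongDual ℝ X, ‖ζ - (ξ - t • v)‖ < κ → ∀ x ∈ D,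
      g ζ ≤ ζ x - F x + κ * (ε / 3) → ∃ b ∈ A, v b < i + δ ∧ ‖b - x‖ ≤ ε / 3 := by
    intro ζ hζ x hx hxα
    obtain ⟨ξ', b, hb, hξ', hbx⟩ := exists_mem_predualSubdiff_near hg ζ hx hκpos hxα
    have he : ‖ξ' - (ξ - t • v)‖ ≤ 2 * κ := by
      linarith [norm_sub_le_norm_sub_add_norm_sub ξ' ζ (ξ - t • v)]
    have hbA : b ∈ A := by
      refine ⟨ξ', ?_, hb⟩
      have h1 : ξ' - ξ₀ = (ξ' - (ξ - t • v)) + (ξ - ξ₀) + -(t • v) := by abel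
      have h2 := norm_add₃_le (a := ξ' - (ξ - t • v)) (b := ξ - ξ₀) (c := -(t • v))
      rw [← h1, norm_neg, norm_smul, Real.norm_of_nonneg htpos.le] at h2
      linarith
    refine ⟨b, hbA, ?_, le_of_mul_le_mul_left hbx hκpos⟩
    have hmono := predualSubdiff_monotone ha hb
    have hsplit : (ξ' - ξ) (b - a) = (ξ' - (ξ - t • v)) (b - a) - t * (v b - v a) := by
      simp only [_root_.sub_apply, map_sub, smul_apply, smul_eq_mul]
      ring
    have hba : ‖b - a‖ ≤ 4 * C := by
      linarith [norm_sub_le b a, hAB b hbA, hAB a ⟨ξ, hξ, ha⟩]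
    have hle : (ξ' - (ξ - t • v)) (b - a) ≤ 2 * κ * (4 * C) :=
      (le_abs_self _).trans (((ξ' - (ξ - t • v)).le_opNorm _).trans
        (mul_le_mul he hba (norm_nonneg _) (by positivity)))
    have : t * (v b - v a) < t * (δ / 2) := by linarith
    have := lt_of_mul_lt_mul_left this htpos.le
    linarith
  refine ⟨ξ - t • v, ?_, κ, hκpos, κ * (ε / 3), by positivity, ?_⟩
  · have h1 := norm_sub_le (ξ - ξ₀) (t • v)
    rw [norm_smul, Real.norm_of_nonneg htpos.le] at h1
    have h2 : ξ - t • v - ξ₀ = ξ - ξ₀ - t • v := by abel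
    rw [h2]
    linarith
  · intro ζ hζ x hx y hy hxα hyα
    obtain ⟨b, hb, hbv, hbx⟩ := hmain ζ hζ x hx hxα
    obtain ⟨c, hc, hcv, hcy⟩ := hmain ζ hζ y hy hyα
    have h1 := hclose b hb c hc hbv hcv
    have h2 := norm_sub_le_norm_sub_add_norm_sub x b y
    have h3 := norm_sub_le_norm_sub_add_norm_sub b c y
    rw [norm_sub_rev] at hbx
    linarith

/-- For a dense set of functionals `ξ`, all maximizing sequences of `ξ - F` on `D` converge. -/
theorem dense_setOf_small_near_maximizers {X : Type*} [NormedAddCommGroup X]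
    [NormedSpace ℝ X] [CompleteSpace X] {D : Set X} {F : X → ℝ} {g : StrongDual ℝ X → ℝ}
    (hg : ∀ ξ : StrongDual ℝ X, IsLUB ((fun x => ξ x - F x) '' D) (g ξ))
    (hbd : ∀ R : ℝ, ∃ C : ℝ, ∀ ξ : StrongDual ℝ X, ‖ξ‖ ≤ R → |g ξ| ≤ C)
    (hD : HasRNP (closedConvexHull ℝ D : Set X)) :
    Dense {ξ : StrongDual ℝ X | ∀ ε > 0, ∃ α > 0, ∀ x ∈ D, ∀ y ∈ D,
      g ξ ≤ ξ x - F x + α → g ξ ≤ ξ y - F y + α → ‖x - y‖ < ε} := by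
  -- Uniformity over a `ρ`-ball of functionals is what makes `O n` open.
  let O : ℕ → Set (StrongDual ℝ X) := fun n => {ξ | ∃ ρ > 0, ∃ α > 0, ∀ ζ : StrongDual ℝ X,
      ‖ζ - ξ‖ < ρ → ∀ x ∈ D, ∀ y ∈ D, g ζ ≤ ζ x - F x + α → g ζ ≤ ζ y - F y + α →
        ‖x - y‖ < 1 / ((n : ℝ) + 1)}
  have hopen : ∀ n, IsOpen (O n) := by
    intro n
    rw [Metric.isOpen_iff]
    rintro ξ ⟨ρ, hρ, α, hα, h⟩
    refine ⟨ρ / 2, half_pos hρ, fun ξ' hξ' => ⟨ρ / 2, half_pos hρ, α, hα, fun ζ hζ => h ζ ?_⟩⟩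
    rw [Metric.mem_ball, dist_eq_norm] at hξ'
    linarith [norm_sub_le_norm_sub_add_norm_sub ζ ξ' ξ]
  have hdense : ∀ n, Dense (O n) := by
    intro n
    rw [Metric.dense_iff]
    intro ξ₀ η hη
    obtain ⟨ξ₁, h1, h2⟩ := exists_uniformly_small_near_maximizers hg hbd hD ξ₀ hη
      (Nat.one_div_pos_of_nat (α := ℝ) (n := n))
    exact ⟨ξ₁, by rwa [Metric.mem_ball, dist_eq_norm], h2⟩
  refine (dense_iInter_of_isOpen hopen hdense).mono fun ξ hξ ε hε => ?_
  obtain ⟨n, hn⟩ := exists_nat_one_div_lt hε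
  obtain ⟨ρ, hρ, α, hα, h⟩ := Set.mem_iInter.1 hξ n
  refine ⟨α, hα, fun x hx y hy hx' hy' => (h ξ ?_ x hx y hy hx' hy').trans hn⟩
  simpa using hρ

/-! ### Extended-real values and superlinear growth -/

theorem IsProperFun.coe_toReal {X : Type*} {f : X → EReal} (hf : IsProperFun f) {x : X}
    (hx : x ∈ effDom f) : (((f x).toReal : ℝ) : EReal) = f x :=
  EReal.coe_toReal (ne_of_lt hx) (hf.1 x)

/-- It suffices to test membership in the subdifferential on the effective domain. -/
theorem IsProperFun.mem_fenchelSubdiff {X : Type*} [NormedAddCommGroup X] [NormedSpace ℝ X]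
    {f : X → EReal} (hf : IsProperFun f) {x : X} (hx : x ∈ effDom f) {ξ : StrongDual ℝ X}
    (h : ∀ y ∈ effDom f, (f x).toReal - ξ x ≤ (f y).toReal - ξ y) : ξ ∈ fenchelSubdiff f x := by
  intro y
  by_cases hy : y ∈ effDom f
  · rw [← hf.coe_toReal hx, ← hf.coe_toReal hy]
    exact_mod_cast h y hy
  · have : f y = ⊤ := not_lt_top_iff.1 hy
    rw [this, EReal.top_sub_coe]
    exact le_top

theorem IsSuperlinear.norm_le_sub {X : Type*} [NormedAddCommGroup X] [NormedSpace ℝ X]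
    {f : X → EReal} (hf : IsProperFun f) (hs : IsSuperlinear f) (R : ℝ) :
    ∃ δ : ℝ, 0 < δ ∧ ∀ ξ : StrongDual ℝ X, ‖ξ‖ ≤ R → ∀ x ∈ effDom f, δ < ‖x‖ →
      ‖x‖ ≤ (f x).toReal - ξ x := by
  -- Slope `|R|` absorbs `ξ`; the extra `1` leaves `‖x‖`.
  obtain ⟨δ, hδ, h⟩ := hs (|R| + 1) (by positivity)
  refine ⟨δ, hδ, fun ξ hξ x hx hxδ => ?_⟩
  have h1 := h x (by simpa using hxδ)
  rw [← hf.coe_toReal hx, EReal.coe_le_coe_iff] at h1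
  have h2 := (le_abs_self _).trans ((ξ.le_opNorm x).trans
    (mul_le_mul_of_nonneg_right (hξ.trans (le_abs_self R)) (norm_nonneg x)))
  linarith

/-! ### Existence of minimizers in the two settings -/

/-- A superlinear weakly lower semicontinuous function on a reflexive space has a minimum after
every linear perturbation. -/
theorem setValuedIm_fenchelSubdiff_eq_univ_of_reflexive {X : Type*} [NormedAddCommGroup X]
    [NormedSpace ℝ X] {f : X → EReal} (hf : IsProperFun f) (hs : IsSuperlinear f)
    (hX : IsReflexiveSpace X) (hw : IsWeaklyLSC f) :
    setValuedIm (fenchelSubdiff f) = Set.univ := by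
  refine Set.eq_univ_of_forall fun ξ => ?_
  obtain ⟨x₀, hx₀⟩ := hf.2
  obtain ⟨δ, -, hgrow⟩ := hs.norm_le_sub hf ‖ξ‖
  set v := (f x₀).toReal - ξ x₀ with hv
  -- The ball contains `x₀`, and outside it `f - ξ` is at least `‖x‖ > r ≥ v`, its value at `x₀`.
  set r := max δ (max v ‖x₀‖) with hr
  let S : Set (WeakSpace ℝ X) := (toWeakSpace ℝ X).symm ⁻¹' Metric.closedBall 0 r
  have hS : IsCompact (closure S) := by
    refine NormedSpace.isCompact_closure_of_isBounded ℝ X S ?_ ?_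
    · have : (toWeakSpace ℝ X) ⁻¹' S = Metric.closedBall 0 r := by
        ext x; simp [S]
      rw [this]
      exact Metric.isBounded_closedBall
    -- Reflexivity: weak-star limits in the bidual are evaluations at points of `X`.
    · intro φ _
      obtain ⟨x, hx⟩ := hX (WeakDual.toStrongDual φ)
      exact ⟨toWeakSpace ℝ X x, DFunLike.ext _ _ fun ζ => DFunLike.congr_fun hx ζ⟩
  have hmem : ∀ x : X, ‖x‖ ≤ r → toWeakSpace ℝ X x ∈ closure S := fun x hx =>
    subset_closure (by simpa [S] using hx)
  have hξ : Continuous fun x : WeakSpace ℝ X => ξ ((toWeakSpace ℝ X).symm x) :=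
    WeakBilin.eval_continuous (topDualPairing ℝ X).flip ξ
  have hlsc : LowerSemicontinuous fun x : WeakSpace ℝ X =>
      f ((toWeakSpace ℝ X).symm x) + ((-ξ ((toWeakSpace ℝ X).symm x) : ℝ) : EReal) := by
    refine LowerSemicontinuous.add' hw
      (continuous_coe_real_ereal.comp hξ.neg).lowerSemicontinuous fun x => ?_
    exact EReal.continuousAt_add (Or.inr (EReal.coe_ne_bot _)) (Or.inr (EReal.coe_ne_top _))
  obtain ⟨z, hz, hmin⟩ := (hlsc.lowerSemicontinuousOn (closure S)).exists_isMinOn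
    ⟨_, hmem x₀ ((le_max_right _ _).trans (le_max_right _ _))⟩ hS
  obtain ⟨x, rfl⟩ := (toWeakSpace ℝ X).surjective z
  have hball : ∀ y, ‖y‖ ≤ r → f x + ((-ξ x : ℝ) : EReal) ≤ f y + ((-ξ y : ℝ) : EReal) := by
    intro y hy
    simpa using hmin (hmem y hy)
  have h0 := hball x₀ ((le_max_right _ _).trans (le_max_right _ _))
  have hx : x ∈ effDom f := by
    rw [← hf.coe_toReal hx₀, ← EReal.coe_add] at h0
    refine Ne.lt_top (a := f x) fun htop => ?_
    rw [htop, EReal.top_add_coe] at h0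
    exact h0.not_gt (EReal.coe_lt_top _)
  have hreal : ∀ y ∈ effDom f, ‖y‖ ≤ r → (f x).toReal - ξ x ≤ (f y).toReal - ξ y := by
    intro y hy hyr
    have := hball y hyr
    rw [← hf.coe_toReal hx, ← hf.coe_toReal hy] at this
    simpa only [sub_eq_add_neg] using (by exact_mod_cast this :
      (f x).toReal + -ξ x ≤ (f y).toReal + -ξ y)
  refine ⟨x, hf.mem_fenchelSubdiff hx fun y hy => ?_⟩
  by_cases hyr : ‖y‖ ≤ r
  · exact hreal y hy hyr
  · rw [not_le] at hyr
    have h1 := hgrow ξ le_rfl y hy ((le_max_left _ _).trans_lt hyr)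
    have h2 := hreal x₀ hx₀ ((le_max_right _ _).trans (le_max_right _ _))
    have h3 : v ≤ r := (le_max_left _ _).trans (le_max_right _ _)
    linarith

/-- Stegall's variational principle for superlinear functions. -/
theorem dense_setValuedIm_fenchelSubdiff {X : Type*} [NormedAddCommGroup X] [NormedSpace ℝ X]
    [CompleteSpace X] {f : X → EReal} (hf : IsProperFun f) (hs : IsSuperlinear f)
    (hlsc : LowerSemicontinuous f) {m : ℝ} (hm : ∀ x, (m : EReal) ≤ f x)
    (hD : HasRNP (closedConvexHull ℝ (effDom f) : Set X)) :
    Dense (setValuedIm (fenchelSubdiff f)) := by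
  set F : X → ℝ := fun x => (f x).toReal with hF
  obtain ⟨x₀, hx₀⟩ := hf.2
  have hub : ∀ R : ℝ, ∃ C : ℝ, ∀ ξ : StrongDual ℝ X, ‖ξ‖ ≤ R → ∀ x ∈ effDom f,
      ξ x - F x ≤ C := by
    intro R
    obtain ⟨δ, hδ, hgrow⟩ := hs.norm_le_sub hf R
    refine ⟨max 0 (R * δ - m), fun ξ hξ x hx => ?_⟩
    by_cases hxδ : δ < ‖x‖
    · have := hgrow ξ hξ x hx hxδ
      exact le_max_of_le_left (by linarith [norm_nonneg x])
    · have h1 := hm x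
      rw [← hf.coe_toReal hx, EReal.coe_le_coe_iff] at h1
      have h2 := (le_abs_self _).trans ((ξ.le_opNorm x).trans
        (mul_le_mul hξ (not_lt.1 hxδ) (norm_nonneg x) ((norm_nonneg ξ).trans hξ)))
      exact le_max_of_le_right (by linarith)
  set g : StrongDual ℝ X → ℝ := fun ξ => sSup ((fun x => ξ x - F x) '' effDom f) with hgdef
  have hg : ∀ ξ : StrongDual ℝ X, IsLUB ((fun x => ξ x - F x) '' effDom f) (g ξ) := by
    intro ξ
    obtain ⟨C, hC⟩ := hub ‖ξ‖
    exact isLUB_csSup (hf.2.image _) ⟨C, by rintro _ ⟨x, hx, rfl⟩; exact hC ξ le_rfl x hx⟩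
  have hbd : ∀ R : ℝ, ∃ C : ℝ, ∀ ξ : StrongDual ℝ X, ‖ξ‖ ≤ R → |g ξ| ≤ C := by
    intro R
    obtain ⟨C, hC⟩ := hub R
    refine ⟨max C (R * ‖x₀‖ + F x₀), fun ξ hξ => abs_le.2 ⟨?_, ?_⟩⟩
    · have h1 := (hg ξ).1 (Set.mem_image_of_mem _ hx₀)
      have h2 := (abs_le.1 ((ξ.le_opNorm x₀).trans
        (mul_le_mul_of_nonneg_right hξ (norm_nonneg x₀)))).1
      have h3 := le_max_right C (R * ‖x₀‖ + F x₀)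
      linarith
    · refine le_max_of_le_left ((hg ξ).2 ?_)
      rintro _ ⟨x, hx, rfl⟩
      exact hC ξ hξ x hx
  refine (dense_setOf_small_near_maximizers hg hbd hD).mono fun ξ hξ => ?_
  have happrox : ∀ n : ℕ, ∃ x ∈ effDom f, g ξ ≤ ξ x - F x + 1 / ((n : ℝ) + 1) := by
    intro n
    obtain ⟨_, ⟨x, hx, rfl⟩, hlt, -⟩ := (hg ξ).exists_between
      (sub_lt_self (g ξ) (Nat.one_div_pos_of_nat (α := ℝ) (n := n)))
    exact ⟨x, hx, by simp only at hlt; linarith⟩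
  choose u huD hu using happrox
  have hcau : CauchySeq u := by
    rw [Metric.cauchySeq_iff]
    intro ε hε
    obtain ⟨α, hα, h⟩ := hξ ε hε
    obtain ⟨N, hN⟩ := exists_nat_one_div_lt hα
    have hnear : ∀ n ≥ N, g ξ ≤ ξ (u n) - F (u n) + α := fun n hn => by
      linarith [hu n, Nat.one_div_le_one_div (α := ℝ) hn]
    refine ⟨N, fun n hn k hk => ?_⟩
    rw [dist_eq_norm]
    exact h _ (huD n) _ (huD k) (hnear n hn) (hnear k hk)
  obtain ⟨x, hx⟩ := cauchySeq_tendsto_of_complete hcau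
  have hle : f x ≤ ((ξ x - g ξ : ℝ) : EReal) := by
    have hlim : Filter.Tendsto (fun n : ℕ => (((ξ (u n) - g ξ + 1 / ((n : ℝ) + 1)) : ℝ) : EReal))
        Filter.atTop (nhds ((ξ x - g ξ + 0 : ℝ) : EReal)) :=
      (continuous_coe_real_ereal.tendsto _).comp
        ((((ξ.continuous.tendsto x).comp hx).sub_const _).add
          tendsto_one_div_add_atTop_nhds_zero_nat)
    rw [add_zero] at hlim
    -- A level `d` strictly below `f x` is eventually exceeded by `f (u n)`, hence by the upper
    -- bounds converging to `ξ x - g ξ`.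
    refine le_of_forall_lt fun c hc => lt_of_not_ge fun hge => ?_
    obtain ⟨d, hcd, hd⟩ := exists_between hc
    have h1 := hx.eventually (hlsc x d hd)
    refine (hge.trans_lt hcd).not_ge (ge_of_tendsto hlim ?_)
    filter_upwards [h1] with n hn
    refine hn.le.trans ?_
    rw [← hf.coe_toReal (huD n), EReal.coe_le_coe_iff]
    linarith [hu n]
  have hxD : x ∈ effDom f := hle.trans_lt (EReal.coe_lt_top _)
  rw [← hf.coe_toReal hxD, EReal.coe_le_coe_iff] at hle
  refine ⟨x, hf.mem_fenchelSubdiff hxD fun y hy => ?_⟩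
  have := (hg ξ).1 (Set.mem_image_of_mem _ hy)
  simp only [hF] at this
  linarith

theorem proposition4p5 {X : Type*} [NormedAddCommGroup X] [NormedSpace ℝ X] [CompleteSpace X]
    (f : X → EReal) (hproper : IsProperFun f) (hsuper : IsSuperlinear f) :
    (IsReflexiveSpace X → IsWeaklyLSC f → setValuedIm (fenchelSubdiff f) = Set.univ) ∧
    (LowerSemicontinuous f → (∃ m : ℝ, ∀ x, (m : EReal) ≤ f x) →
      HasRNP (closedConvexHull ℝ (effDom f)) →
      closure (setValuedIm (fenchelSubdiff f)) = Set.univ) := by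
  exact ⟨setValuedIm_fenchelSubdiff_eq_univ_of_reflexive hproper hsuper,
    fun hlsc ⟨_, hm⟩ hD =>
      (dense_setValuedIm_fenchelSubdiff hproper hsuper hlsc hm hD).closure_eq⟩
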